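/- Let $T_1,T_2$ be locally finite trees, and give each automorphism group $\mathrm{Aut}\,T_i$ the topology of pointwise convergence on vertices. For a subgroup $H<\mathrm{Aut}\,T$ and a vertex $x$ of $T$, let $\underline{H}(x)<\mathrm{Sym}\,E(x)$ denote the finite permutation group which the stabilizer $H(x)$ induces on the set $E(x)$ of edges issued from $x$. We say that $H$ is *locally quasi-primitive* if for every vertex $x$ every non-trivial normal subgroup of $\underline{H}(x)$ acts transitively on $E(x)$, and that $H$ is of *constant type* if there is a fixed finite permutation group to which all the $\underline{H}(x)$ are isomorphic as permutation groups. A group $A$ is a *section* of a group $B$ if $A\cong L/K$ for some $K\trianglelefteq L\le B$. For $i=1,2$ let $G_i<\mathrm{Aut}\,T_i$ be a closed, non-discrete, locally quasi-primitive subgroup of constant type. Let $\Gamma<G_1\times G_2$ be a cocompact lattice (a discrete subgroup with compact quotient) whose projection to each factor $G_i$ is dense in $G_i$. Then there is a neighborhood $W$ of $(e,e)$ in $G_1\times G_2$ with the following property. If there is a discrete subgroup $\Lambda<G_1\times G_2$ with $\Lambda\supseteq\Gamma$ and $\Lambda\cap W\neq\{(e,e)\}$, then $M_1$ is a section of $S_2$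 and $M_2$ is a section of $S_1$. Here $M_i$ is any simple factor (simple direct factor) of any minimal normal subgroup of $\underline{G}_i(x)$, and $S_i$ is the stabilizer in $\underline{G}_i(x)$ of any element of $E(x)$, for any vertex $x$ of $T_i$; the vertices used for $M_i$ and for $S_i$ need not be the same. -/

import Mathlib

open Topology

/-- The topology of pointwise convergence on the automorphism group of a graph, the vertex set
being discrete: the coarsest topology making every evaluation `g ↦ g x` locally constant. For a
locally finite connected graph this is the compact-open topology. -/
instance graphAutTopology {V : Type*} (T : SimpleGraph V) : TopologicalSpace (T ≃g T) :=
  ⨅ x : V, TopologicalSpace.induced (fun g : T ≃g T => g x) ⊥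

/-- The action of the stabilizer of `x` on the set of edges issued from `x`. An edge issued from
`x` is recorded by its other end point, a neighbour of `x`. -/
def localAction {V : Type*} (T : SimpleGraph V) (x : V) :
    MulAction.stabilizer (T ≃g T) x →* Equiv.Perm (T.neighborSet x) where
  toFun g := g.1.toEquiv.subtypeEquiv (fun y => by
    have hg : g.1 x = x := g.2
    have h : T.Adj (g.1 x) (g.1 y) ↔ T.Adj x y := g.1.map_rel_iff
    rw [hg] at h
    exact h.symm)
  map_one' := rfl
  map_mul' _ _ := rfl

/-- The local permutation group of `H` at `x`: the group of permutations of the set of edges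
issued from `x` that is induced by the stabilizer of `x` in `H`. -/
def localGroup {V : Type*} {T : SimpleGraph V} (H : Subgroup (T ≃g T)) (x : V) :
    Subgroup (Equiv.Perm (T.neighborSet x)) :=
  (H.subgroupOf (MulAction.stabilizer (T ≃g T) x)).map (localAction T x)

/-- A permutation group is quasi-primitive if each of its non-trivial normal subgroups acts
transitively. -/
def IsQuasiPrimitivePermGroup {Ω : Type*} (F : Subgroup (Equiv.Perm Ω)) : Prop :=
  ∀ N : Subgroup F, N.Normal → N ≠ ⊥ → MulAction.IsPretransitive N Ω

/-- `H` is locally quasi-primitive: all its local permutation groups are quasi-primitive. -/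
def IsLocallyQuasiPrimitive {V : Type*} {T : SimpleGraph V} (H : Subgroup (T ≃g T)) : Prop :=
  ∀ x : V, IsQuasiPrimitivePermGroup (localGroup H x)

/-- Two permutation groups are isomorphic as permutation groups: some bijection of the underlying
sets conjugates one to the other. -/
def PermGroupIso {Ω Ω' : Type*} (F : Subgroup (Equiv.Perm Ω)) (F' : Subgroup (Equiv.Perm Ω')) :
    Prop :=
  ∃ e : Ω ≃ Ω', ∀ σ : Equiv.Perm Ω, σ ∈ F ↔ e.permCongr σ ∈ F'

/-- `H` is of constant type: its local permutation groups are all isomorphic, as permutation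
groups, to one fixed finite permutation group. -/
def IsConstantType {V : Type*} {T : SimpleGraph V} (H : Subgroup (T ≃g T)) : Prop :=
  ∃ (d : ℕ) (F : Subgroup (Equiv.Perm (Fin d))), ∀ x : V, PermGroupIso (localGroup H x) F

/-- `N` is a minimal normal subgroup of `F`: minimal among the non-trivial normal subgroups. -/
def IsMinimalNormalSubgroup {F : Type*} [Group F] (N : Subgroup F) : Prop :=
  N.Normal ∧ N ≠ ⊥ ∧ ∀ K : Subgroup F, K.Normal → K ≠ ⊥ → K ≤ N → K = N

/-- `M` is a simple factor of `N`: a simple group such that `N` is the internal direct product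
of `M` and a further subgroup `C`. -/
def IsSimpleFactor {F : Type*} [Group F] (M N : Subgroup F) : Prop :=
  IsSimpleGroup M ∧
    ∃ C : Subgroup F, (∀ m ∈ M, ∀ c ∈ C, m * c = c * m) ∧ M ⊓ C = ⊥ ∧ M ⊔ C = N

/-- `A` is a section of `B`: it is isomorphic to `H ⧸ K` for some `K ⊴ H ≤ B`. -/
def IsSection (A B : Type*) [Group A] [Group B] : Prop :=
  ∃ (H : Subgroup B) (K : Subgroup H) (_ : K.Normal), Nonempty (A ≃* H ⧸ K)

/-- `Γ` is a cocompact lattice in the topological group `G`: a discrete subgroup with compact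
quotient. -/
def IsCocompactLattice {G : Type*} [Group G] [TopologicalSpace G] (Γ : Subgroup G) : Prop :=
  DiscreteTopology Γ ∧ CompactSpace (G ⧸ Γ)

/-!
Let `Λ ⊇ Γ` be discrete, and let `l ∈ Λ`, `l ≠ 1`, fix a vertex `x₁` of `T₁` and a large ball around
a fixed vertex `x₂` of `T₂`. It is enough to show that the simple factors `M₁` for `G₁` are sections
of the point stabilizers `S₂` for `G₂`: the two ways of ordering the factors give two
neighbourhoods, whose intersection is `W`.

* A discrete normal subgroup of `G₂` acts freely on the vertices of `T₂`
  (`eq_one_of_mem_normal_of_apply_eq`), by local quasi-primitivity and non-discreteness. Hence an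
  element of `Λ` acting trivially on one tree and fixing a vertex of the other is `1`
  (`IsDiscreteDensePair.eq_one`). In particular `l` acts non-trivially on `T₁`, so there is a
  vertex `y` of `T₁` fixed by `l` at which `l` acts non-trivially on the edges.
* Since `Γ` is dense in `G₁` and cocompact, there is a constant `D`, depending on `Γ` and `x₂` only,
  such that at each vertex of `T₁` the local group of `G₁` is induced by elements of `Γ` displacing
  `x₂` by at most `D` (`BoundedOnOrbits.exists_displacement_bound`). Conjugation by these
  elements carries the fixator in `Λ` of `y` and the ball of radius `r + D` around `x₂` into the
  fixator for the radius `r`. The local groups at `y` of these fixators decrease with the radius, in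
  a finite group of bounded order, so for some bounded `r ≥ 1` the radii `r` and `r + D` give the
  same group, which is then normal in the local group of `G₁`
  (`conj_mem_localGroup_vertexBallFixator`). It is not trivial because of `l`.
* In a quasi-primitive group, a simple factor of a minimal normal subgroup is a section of each
  non-trivial normal subgroup (`isSection_of_isSimpleFactor`). So `M₁` is a section of the
  fixator in `Λ` of `y` and a ball of radius `r ≥ 1`, a finite group that acts faithfully on `T₂`
  and fixes a star pointwise. A simple section of such a group is a section of `S₂`
  (`exists_isSection_stabilizer`).

The topology is handled through agreement on finite sets of vertices (`IsDiscreteDensePair`), and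
cocompactness through `BoundedOnOrbits`; both notions are symmetric in the two factors.
-/

/-! ### Sections of groups -/

/-- A group `L` mapping onto `A` whose map to `B` kills no more than the map to `A` does exhibits
`A` as a section of `B`. -/
theorem IsSection.of_ker_le {A B L : Type*} [Group A] [Group B] [Group L] (φ : L →* B)
    (f : L →* A) (hf : Function.Surjective f) (h : φ.ker ≤ f.ker) : IsSection A B := by
  let ψ : φ.range →* A :=
    (QuotientGroup.lift φ.ker f h).comp (QuotientGroup.quotientKerEquivRange φ).symm.toMonoidHom
  have hψ : Function.Surjective ψ := by
    intro a
    obtain ⟨l, rfl⟩ := hf a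
    exact ⟨QuotientGroup.quotientKerEquivRange φ (QuotientGroup.mk l), by simp [ψ]⟩
  exact ⟨φ.range, ψ.ker, inferInstance,
    ⟨(QuotientGroup.quotientKerEquivOfSurjective ψ hψ).symm⟩⟩

theorem IsSection.exists_surjective {A B : Type*} [Group A] [Group B] (h : IsSection A B) :
    ∃ (L : Subgroup B) (f : L →* A), Function.Surjective f := by
  obtain ⟨L, K, hK, ⟨e⟩⟩ := h
  exact ⟨L, e.symm.toMonoidHom.comp (QuotientGroup.mk' K),
    e.symm.surjective.comp (QuotientGroup.mk'_surjective K)⟩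

theorem IsSection.of_injective {A B C : Type*} [Group A] [Group B] [Group C]
    (h : IsSection A B) (i : B →* C) (hi : Function.Injective i) : IsSection A C := by
  obtain ⟨L, f, hf⟩ := h.exists_surjective
  refine IsSection.of_ker_le (i.comp L.subtype) f hf ?_
  rw [(MonoidHom.ker_eq_bot_iff _).2 (by exact hi.comp L.subtype_injective)]
  exact bot_le

theorem IsSection.of_surjective {A B C : Type*} [Group A] [Group B] [Group C]
    (h : IsSection A B) (p : C →* B) (hp : Function.Surjective p) : IsSection A C := by
  obtain ⟨L, f, hf⟩ := h.exists_surjective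
  refine IsSection.of_ker_le (L.comap p).subtype (f.comp (p.subgroupComap L))
    (hf.comp (p.subgroupComap_surjective_of_surjective L hp)) ?_
  rw [(MonoidHom.ker_eq_bot_iff _).2 (L.comap p).subtype_injective]
  exact bot_le

theorem IsSection.of_le {A G : Type*} [Group A] [Group G] {H K : Subgroup G}
    (h : IsSection A H) (hle : H ≤ K) : IsSection A K :=
  h.of_injective (Subgroup.inclusion hle) (Subgroup.inclusion_injective hle)

theorem IsSection.refl (A : Type*) [Group A] : IsSection A A :=
  IsSection.of_ker_le (MonoidHom.id A) (MonoidHom.id A) Function.surjective_id le_rfl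

/-! ### Quasi-primitive permutation groups -/

section Perm

variable {Ω Ω' Ω'' : Type*}

theorem PermGroupIso.symm {F : Subgroup (Equiv.Perm Ω)} {F' : Subgroup (Equiv.Perm Ω')}
    (h : PermGroupIso F F') : PermGroupIso F' F := by
  obtain ⟨e, he⟩ := h
  refine ⟨e.symm, fun σ => ?_⟩
  rw [he]
  have : e.permCongr (e.symm.permCongr σ) = σ := by ext; simp
  rw [this]

theorem PermGroupIso.trans {F : Subgroup (Equiv.Perm Ω)} {F' : Subgroup (Equiv.Perm Ω')}
    {F'' : Subgroup (Equiv.Perm Ω'')} (h : PermGroupIso F F') (h' : PermGroupIso F' F'') :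
    PermGroupIso F F'' := by
  obtain ⟨e, he⟩ := h
  obtain ⟨e', he'⟩ := h'
  exact ⟨e.trans e', fun σ => (he σ).trans (he' _)⟩

theorem PermGroupIso.eq_bot {F : Subgroup (Equiv.Perm Ω)} {F' : Subgroup (Equiv.Perm Ω')}
    (h : PermGroupIso F F') (hF : F = ⊥) : F' = ⊥ := by
  obtain ⟨e, he⟩ := h.symm
  rw [Subgroup.eq_bot_iff_forall]
  intro σ hσ
  have h1 := (he σ).1 hσ
  rw [hF, Subgroup.mem_bot] at h1
  have h2 : e.permCongr σ = e.permCongr 1 := by rw [h1]; ext; simp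
  exact e.permCongr.injective h2

theorem IsQuasiPrimitivePermGroup.exists_apply_eq {F N : Subgroup (Equiv.Perm Ω)}
    (hF : IsQuasiPrimitivePermGroup F) (hNF : N ≤ F)
    (hN : ∀ f ∈ F, ∀ n ∈ N, f * n * f⁻¹ ∈ N) (hne : N ≠ ⊥) (a b : Ω) : ∃ n ∈ N, n a = b := by
  have hnormal : (N.subgroupOf F).Normal :=
    ⟨fun n hn g => hN g g.2 n hn⟩
  have hbot : N.subgroupOf F ≠ ⊥ := by
    intro h
    rw [Subgroup.subgroupOf_eq_bot] at h
    exact hne (by rw [← h.eq_bot, inf_eq_left.2 hNF])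
  obtain ⟨n, hn⟩ := (hF _ hnormal hbot).exists_smul_eq a b
  exact ⟨n.1.1, n.2, hn⟩

/-- If a second normal subgroup `P` does not contain the minimal normal subgroup `N`, then `P` and
`N` commute and are both transitive. The stabilizer of a point in `P × N` is then a subgroup of `P`
that maps onto `N`. -/
theorem isSection_of_isSimpleFactor {F : Subgroup (Equiv.Perm Ω)}
    (hF : IsQuasiPrimitivePermGroup F) {N M : Subgroup F} (hN : IsMinimalNormalSubgroup N)
    (hM : IsSimpleFactor M N) {P : Subgroup (Equiv.Perm Ω)} (hPF : P ≤ F)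
    (hP : ∀ f ∈ F, ∀ p ∈ P, f * p * f⁻¹ ∈ P) (hne : P ≠ ⊥) : IsSection M P := by
  obtain ⟨hNn, hNb, hNmin⟩ := hN
  obtain ⟨-, C, -, -, hMC⟩ := hM
  have hMN : M ≤ N := hMC ▸ le_sup_left
  suffices h : IsSection N P by
    obtain ⟨L, f, hf⟩ := h.exists_surjective
    have : IsSection M L := (IsSection.refl _).of_injective (Subgroup.inclusion hMN)
      (Subgroup.inclusion_injective hMN) |>.of_surjective f hf
    exact this.of_injective L.subtype L.subtype_injective
  have hPn : (P.subgroupOf F).Normal := ⟨fun n hn g => hP g g.2 n hn⟩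
  by_cases hinf : P.subgroupOf F ⊓ N = ⊥
  · have hcomm : ∀ p ∈ P.subgroupOf F, ∀ n ∈ N, p * n = n * p := by
      intro p hp n hn
      have h1 : p * n * p⁻¹ * n⁻¹ ∈ P.subgroupOf F ⊓ N := by
        refine ⟨?_, N.mul_mem (hNn.conj_mem n hn p) (N.inv_mem hn)⟩
        have := (P.subgroupOf F).mul_mem hp (hPn.conj_mem _ ((P.subgroupOf F).inv_mem hp) n)
        simpa [mul_assoc] using this
      rw [hinf, Subgroup.mem_bot] at h1
      have h2 := mul_inv_eq_one.1 h1
      exact mul_inv_eq_iff_eq_mul.1 h2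
    have hPt := hF.exists_apply_eq hPF hP hne
    have hcomm' : ∀ p ∈ P, ∀ n ∈ N, ∀ b : Ω, p (n.1 b) = n.1 (p b) := fun p hp n hn b =>
      congrArg (fun g : F => g.1 b) (hcomm ⟨p, hPF hp⟩ hp n hn)
    obtain ⟨x, hx⟩ := Subgroup.ne_bot_iff_exists_ne_one.1 hNb
    have hΩ : ∃ a : Ω, x.1.1 a ≠ a := by
      by_contra! h
      exact hx (Subtype.ext (Subtype.ext (Equiv.ext h)))
    obtain ⟨a, -⟩ := hΩ
    let R : Subgroup (P × N) :=
      { carrier := {z | z.1.1 (z.2.1.1 a) = a}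
        one_mem' := rfl
        mul_mem' := by
          rintro ⟨p, n⟩ ⟨p', n'⟩ h h'
          change p.1 (p'.1 (n.1.1 (n'.1.1 a))) = a
          rw [hcomm' _ p'.2 _ n.2]
          exact (congrArg (fun b => p.1 (n.1.1 b)) h').trans h
        inv_mem' := by
          rintro ⟨p, n⟩ h
          change p.1⁻¹ (n.1.1⁻¹ a) = a
          rw [Equiv.Perm.inv_eq_iff_eq, Equiv.Perm.inv_eq_iff_eq, ← hcomm' _ p.2 _ n.2]
          exact h.symm }
    refine IsSection.of_ker_le ((MonoidHom.fst P N).comp R.subtype)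
      ((MonoidHom.snd P N).comp R.subtype) ?_ ?_
    · intro n
      obtain ⟨p, hp, hpa⟩ := hPt (n.1.1 a) a
      exact ⟨⟨(⟨p, hp⟩, n), hpa⟩, rfl⟩
    · rintro ⟨⟨p, n⟩, hpn⟩ h
      have hp : p = 1 := h
      have hna : n.1.1 a = a := by
        have h1 : p.1 (n.1.1 a) = a := hpn
        rwa [hp] at h1
      have hn : n = 1 := by
        refine Subtype.ext (Subtype.ext (Equiv.ext fun b => ?_))
        obtain ⟨q, hq, rfl⟩ := hPt a b
        rw [← hcomm' q hq _ n.2, hna]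
        rfl
      exact hn
  · have h1 := hNmin _ (Subgroup.normal_inf_normal _ _) hinf inf_le_right
    have h2 : N ≤ P.subgroupOf F := h1 ▸ inf_le_left
    refine ((IsSection.refl N).of_le h2).of_injective (F.subtype.subgroupComap P) ?_
    intro x y h
    exact Subtype.ext (Subtype.ext (congrArg (fun z : P => z.1) h))

/-- In isomorphic permutation groups, one of which is transitive, all point stabilizers have the
same sections. -/
theorem PermGroupIso.isSection_stabilizer {F : Subgroup (Equiv.Perm Ω)}
    {F' : Subgroup (Equiv.Perm Ω')} (h : PermGroupIso F F') (a : Ω) (b : Ω')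
    (ht : ∀ b' : Ω', ∃ τ ∈ F', τ b' = b) {M : Type*} [Group M]
    (hM : IsSection M (MulAction.stabilizer F a)) :
    IsSection M (MulAction.stabilizer F' b) := by
  obtain ⟨e₀, he₀⟩ := h
  obtain ⟨τ, hτ, hτb⟩ := ht (e₀ a)
  -- Following `e₀` by an element of `F'` makes it carry `a` to `b`.
  let e : Ω ≃ Ω' := e₀.trans τ
  have hea : e.symm b = a := by rw [Equiv.symm_apply_eq]; exact hτb.symm
  have he : ∀ σ ∈ F, e.permCongrHom σ ∈ F' := by
    intro σ hσ
    have h1 : e.permCongrHom σ = τ * e₀.permCongr σ * τ⁻¹ := by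
      ext x
      rfl
    rw [h1]
    exact F'.mul_mem (F'.mul_mem hτ ((he₀ σ).1 hσ)) (F'.inv_mem hτ)
  let φ : MulAction.stabilizer F a →* MulAction.stabilizer F' b :=
    ((e.permCongrHom.toMonoidHom.comp
      (F.subtype.comp (MulAction.stabilizer F a).subtype)).codRestrict F'
        (fun s => he _ s.1.2)).codRestrict _ (fun s => by
          change e (s.1.1 (e.symm b)) = b
          have hs : s.1.1 a = a := s.2
          rw [hea, hs, ← hea, Equiv.apply_symm_apply])
  refine hM.of_injective φ fun s t hst => ?_
  have h1 : e.permCongrHom s.1.1 = e.permCongrHom t.1.1 :=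
    congrArg (fun z : MulAction.stabilizer F' b => z.1.1) hst
  exact Subtype.ext (Subtype.ext (e.permCongrHom.injective h1))

/-- The version of `isSection_of_isSimpleFactor` in which the normal subgroup `P` lives in an
isomorphic permutation group. -/
theorem PermGroupIso.isSection_of_isSimpleFactor {F : Subgroup (Equiv.Perm Ω)}
    {F' : Subgroup (Equiv.Perm Ω')} (h : PermGroupIso F F')
    (hF : IsQuasiPrimitivePermGroup F) {N M : Subgroup F} (hN : IsMinimalNormalSubgroup N)
    (hM : IsSimpleFactor M N) {P : Subgroup (Equiv.Perm Ω')} (hPF : P ≤ F')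
    (hP : ∀ f ∈ F', ∀ p ∈ P, f * p * f⁻¹ ∈ P) (hne : P ≠ ⊥) : IsSection M P := by
  obtain ⟨e, he⟩ := h
  let c : Equiv.Perm Ω →* Equiv.Perm Ω' := e.permCongrHom.toMonoidHom
  have hc : Function.Bijective c := e.permCongrHom.bijective
  have hs : IsSection M (P.comap c) := by
    refine _root_.isSection_of_isSimpleFactor hF hN hM (fun σ hσ => (he σ).2 (hPF hσ)) ?_ ?_
    · intro f hf p hp
      rw [Subgroup.mem_comap, map_mul, map_mul, map_inv]
      exact hP _ ((he f).1 hf) _ hp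
    · intro h0
      apply hne
      rw [← Subgroup.map_comap_eq_self_of_surjective hc.2 P, h0, Subgroup.map_bot]
  refine hs.of_injective (c.subgroupComap P) fun x y hxy => ?_
  exact Subtype.ext (hc.1 (congrArg (fun z : P => z.1) hxy))

end Perm

/-! ### Local groups of subgroups of the automorphism group of a graph -/

section Local

variable {V : Type*} {T : SimpleGraph V}

theorem mem_localGroup_iff {H : Subgroup (T ≃g T)} {x : V}
    {σ : Equiv.Perm (T.neighborSet x)} :
    σ ∈ localGroup H x ↔ ∃ g ∈ H, g x = x ∧ ∀ w : T.neighborSet x, (σ w : V) = g w := by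
  constructor
  · rintro ⟨g, hg, rfl⟩
    exact ⟨g.1, hg, g.2, fun w => rfl⟩
  · rintro ⟨g, hg, hx, hσ⟩
    exact ⟨⟨g, hx⟩, hg, Equiv.ext fun w => Subtype.ext (hσ w).symm⟩

theorem localAction_mem_localGroup {H : Subgroup (T ≃g T)} {x : V} {g : T ≃g T} (hg : g ∈ H)
    (hx : g x = x) : localAction T x ⟨g, hx⟩ ∈ localGroup H x :=
  ⟨⟨g, hx⟩, hg, rfl⟩

theorem exists_mem_localGroup {H : Subgroup (T ≃g T)} {x : V} {g : T ≃g T} (hg : g ∈ H)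
    (hx : g x = x) : ∃ σ ∈ localGroup H x, ∀ w : T.neighborSet x, (σ w : V) = g w :=
  ⟨localAction T x ⟨g, hx⟩, localAction_mem_localGroup hg hx, fun _ => rfl⟩

theorem localGroup_eq_bot_iff {H : Subgroup (T ≃g T)} {x : V} :
    localGroup H x = ⊥ ↔ ∀ g ∈ H, g x = x → ∀ w, T.Adj x w → g w = w := by
  rw [Subgroup.eq_bot_iff_forall]
  constructor
  · intro h g hg hx w hw
    obtain ⟨σ, hσ, h1⟩ := exists_mem_localGroup hg hx
    have h2 := h1 ⟨w, hw⟩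
    rw [h σ hσ] at h2
    exact h2.symm
  · intro h σ hσ
    obtain ⟨g, hg, hx, h1⟩ := mem_localGroup_iff.1 hσ
    exact Equiv.ext fun w => Subtype.ext ((h1 w).trans (h g hg hx w w.2))

theorem localGroup_mono {H K : Subgroup (T ≃g T)} (h : H ≤ K) (x : V) :
    localGroup H x ≤ localGroup K x := by
  intro σ hσ
  obtain ⟨g, hg, h1⟩ := mem_localGroup_iff.1 hσ
  exact mem_localGroup_iff.2 ⟨g, h hg, h1⟩

theorem inv_apply_eq_self {g : T ≃g T} {v : V} (h : g v = v) : g⁻¹ v = v := by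
  conv_lhs => rw [← h]
  exact RelIso.inv_apply_self g v

/-- An automorphism conjugating `K` into `H`, with local action `τ` at a fixed vertex, gives a
conjugation by `τ` of the local groups. -/
theorem conj_mem_localGroup {H K : Subgroup (T ≃g T)} {x : V} {g : T ≃g T} (hx : g x = x)
    (hconj : ∀ k ∈ K, k x = x → g * k * g⁻¹ ∈ H) {τ : Equiv.Perm (T.neighborSet x)}
    (hτ : ∀ w, (τ w : V) = g w) {σ : Equiv.Perm (T.neighborSet x)} (hσ : σ ∈ localGroup K x) :
    τ * σ * τ⁻¹ ∈ localGroup H x := by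
  obtain ⟨k, hk, hkx, h1⟩ := mem_localGroup_iff.1 hσ
  refine mem_localGroup_iff.2 ⟨g * k * g⁻¹, hconj k hk hkx, ?_, fun w => ?_⟩
  · simp only [RelIso.mul_apply]
    rw [inv_apply_eq_self hx, hkx, hx]
  · have h2 : g⁻¹ (w : V) = (τ⁻¹ w : T.neighborSet x) := by
      rw [show (w : V) = g (τ⁻¹ w : T.neighborSet x) by rw [← hτ]; simp]
      exact RelIso.inv_apply_self g _
    simp only [Equiv.Perm.mul_apply, RelIso.mul_apply]
    rw [hτ, h1, h2]

theorem eq_one_of_forall_adj (hT : T.Connected) {g : T ≃g T} {x : V} (hx : g x = x)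
    (h : ∀ v, g v = v → ∀ w, T.Adj v w → g w = w) : g = 1 := by
  refine RelIso.ext fun v => ?_
  obtain ⟨p⟩ := hT.preconnected x v
  induction p with
  | nil => exact hx
  | cons hadj p ih => exact ih (h _ hx _ hadj)

/-- Induction along walks from a base vertex of a connected graph. -/
theorem SimpleGraph.Connected.induction_adj (hT : T.Connected) {p : V → Prop} {x : V} (hx : p x)
    (h : ∀ v w, T.Adj v w → p v → p w) (v : V) : p v := by
  obtain ⟨q⟩ := hT.preconnected x v
  induction q with
  | nil => exact hx
  | cons hadj q ih => exact ih (h _ _ hadj hx)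

theorem dist_apply_apply (g : T ≃g T) (v w : V) : T.dist (g v) (g w) = T.dist v w := by
  have key : ∀ (k : T ≃g T) (v w : V), T.Reachable v w → T.dist (k v) (k w) ≤ T.dist v w := by
    intro k v w h
    obtain ⟨p, hp⟩ := h.exists_walk_length_eq_dist
    rw [← hp, ← SimpleGraph.Walk.length_map k.toHom p]
    exact SimpleGraph.dist_le _
  by_cases h : T.Reachable v w
  · refine le_antisymm (key g v w h) ?_
    have := key g⁻¹ (g v) (g w) (h.map g.toHom)
    simpa only [RelIso.inv_apply_self] using this
  · rw [SimpleGraph.dist_eq_zero_of_not_reachable h,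
      SimpleGraph.dist_eq_zero_of_not_reachable fun h' => h (g.reachable_iff.1 h')]

theorem finite_setOf_dist_le (hT : T.Connected) (hfin : ∀ x, (T.neighborSet x).Finite)
    (x : V) (n : ℕ) : {v | T.dist x v ≤ n}.Finite := by
  induction n with
  | zero =>
    refine (Set.finite_singleton x).subset fun v hv => ?_
    exact ((hT.dist_eq_zero_iff).1 (Nat.le_zero.1 hv)).symm
  | succ n ih =>
    refine (ih.union (ih.biUnion fun v _ => hfin v)).subset fun v hv => ?_
    rcases Nat.lt_or_ge n (T.dist x v) with h | h
    · have h1 : T.dist x v = n + 1 := le_antisymm hv h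
      obtain ⟨p, hp⟩ := hT.exists_walk_length_eq_dist v x
      cases p with
      | nil => simp at h
      | @cons _ w _ hadj p =>
        refine Or.inr (Set.mem_biUnion (x := w) ?_ hadj.symm)
        have h2 := SimpleGraph.dist_le p
        rw [SimpleGraph.Walk.length_cons, SimpleGraph.dist_comm, h1] at hp
        rw [SimpleGraph.dist_comm] at h2
        exact h2.trans (by omega)
    · exact Or.inl h

theorem exists_subset_setOf_dist_le (x : V) {F : Set V} (hF : F.Finite) :
    ∃ m, ∀ v ∈ F, T.dist x v ≤ m := by
  obtain ⟨m, hm⟩ := (hF.image fun v => T.dist x v).bddAbove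
  exact ⟨m, fun v hv => hm ⟨v, hv, rfl⟩⟩

/-- A tree contains no quadrilateral. -/
theorem eq_of_adj_of_adj (hT : T.IsTree) {a b c d : V} (hab : a ≠ b) (hca : T.Adj a c)
    (hcb : T.Adj c b) (hda : T.Adj a d) (hdb : T.Adj d b) : c = d := by
  let p : T.Walk a b := .cons hca (.cons hcb .nil)
  let q : T.Walk a b := .cons hda (.cons hdb .nil)
  have hp : p.IsPath := by
    simp [p, SimpleGraph.Walk.cons_isPath_iff, hab, hca.ne, hcb.ne]
  have hq : q.IsPath := by
    simp [q, SimpleGraph.Walk.cons_isPath_iff, hab, hda.ne, hdb.ne]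
  have h := (hT.isAcyclic.subsingleton_path a b).elim ⟨p, hp⟩ ⟨q, hq⟩
  have h1 : p = q := congrArg Subtype.val h
  have h2 := congrArg SimpleGraph.Walk.support h1
  simp [p, q] at h2
  exact h2

/-! ### Locally transitive groups -/

/-- A subgroup of the automorphism group of a graph in which no fixator of a finite set of vertices
is trivial. -/
def HasNontrivialFixators (G : Subgroup (T ≃g T)) : Prop :=
  ∀ F : Set V, F.Finite → ∃ g ∈ G, g ≠ 1 ∧ ∀ v ∈ F, g v = v

theorem IsConstantType.permGroupIso {G : Subgroup (T ≃g T)} (hct : IsConstantType G) (x y : V) :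
    PermGroupIso (localGroup G x) (localGroup G y) := by
  obtain ⟨d, F, h⟩ := hct
  exact (h x).trans (h y).symm

theorem localGroup_ne_bot (hT : T.Connected) {G : Subgroup (T ≃g T)}
    (hnd : HasNontrivialFixators G) (hct : IsConstantType G) (x : V) : localGroup G x ≠ ⊥ := by
  intro h
  obtain ⟨g, hg, hne, hgx⟩ := hnd {x} (Set.finite_singleton x)
  refine hne (eq_one_of_forall_adj hT (hgx x rfl) fun v hv w hw => ?_)
  exact localGroup_eq_bot_iff.1 ((hct.permGroupIso x v).eq_bot h) g hg hv w hw

theorem IsLocallyQuasiPrimitive.exists_localGroup_apply_eq {G : Subgroup (T ≃g T)}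
    (hqp : IsLocallyQuasiPrimitive G) {x : V} (hne : localGroup G x ≠ ⊥) (a b : T.neighborSet x) :
    ∃ σ ∈ localGroup G x, σ a = b :=
  (hqp x).exists_apply_eq le_rfl
    (fun _ hf _ hn => mul_mem (mul_mem hf hn) (inv_mem hf)) hne a b

/-- Transitivity of the local group at `x` of `G`, in terms of elements of `G`. -/
theorem IsLocallyQuasiPrimitive.exists_apply_eq {G : Subgroup (T ≃g T)}
    (hqp : IsLocallyQuasiPrimitive G) {x : V} (hne : localGroup G x ≠ ⊥) {a b : V}
    (ha : T.Adj x a) (hb : T.Adj x b) : ∃ g ∈ G, g x = x ∧ g a = b := by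
  obtain ⟨σ, hσ, h⟩ := hqp.exists_localGroup_apply_eq hne ⟨a, ha⟩ ⟨b, hb⟩
  obtain ⟨g, hg, hx, h1⟩ := mem_localGroup_iff.1 hσ
  exact ⟨g, hg, hx, by rw [← h1 ⟨a, ha⟩, h]⟩

theorem exists_adj_ne_of_localGroup_ne_bot {G : Subgroup (T ≃g T)} {x : V}
    (hne : localGroup G x ≠ ⊥) (a : V) : ∃ b, T.Adj x b ∧ b ≠ a := by
  by_contra! h
  refine hne (localGroup_eq_bot_iff.2 fun g _ hx w hw => ?_)
  have h1 : T.Adj x (g w) := by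
    have := g.map_rel_iff.2 hw
    rwa [hx] at this
  rw [h _ h1, h _ hw]

theorem exists_adj_of_localGroup_ne_bot {G : Subgroup (T ≃g T)} {x : V}
    (hne : localGroup G x ≠ ⊥) : ∃ a, T.Adj x a := by
  by_contra! h
  exact hne (localGroup_eq_bot_iff.2 fun g _ hx w hw => (h w hw).elim)

/-- Any vertex is equivalent to one of the two ends of a given edge. -/
theorem exists_apply_eq_or (hT : T.Connected) {G : Subgroup (T ≃g T)}
    (hqp : IsLocallyQuasiPrimitive G) (hne : ∀ x, localGroup G x ≠ ⊥) {a b : V}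
    (hab : T.Adj a b) (v : V) : ∃ g ∈ G, g a = v ∨ g b = v := by
  have key : ∀ a b, T.Adj a b → ∀ g ∈ G, ∀ w, T.Adj (g a) w → ∃ h ∈ G, h b = w := by
    intro a b hab g hg w hw
    have h1 : T.Adj a (g⁻¹ w) := by
      rw [← g.map_rel_iff]
      simpa only [RelIso.apply_inv_self] using hw
    obtain ⟨h, hh, -, hb⟩ := hqp.exists_apply_eq (hne a) hab h1
    exact ⟨g * h, mul_mem hg hh, by rw [RelIso.mul_apply, hb, RelIso.apply_inv_self]⟩
  refine hT.induction_adj (p := fun v => ∃ g ∈ G, g a = v ∨ g b = v) (x := a)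
    ⟨1, one_mem _, Or.inl rfl⟩ ?_ v
  rintro v w hvw ⟨g, hg, rfl | rfl⟩
  · obtain ⟨h, hh, h1⟩ := key a b hab g hg w hvw
    exact ⟨h, hh, Or.inr h1⟩
  · obtain ⟨h, hh, h1⟩ := key b a hab.symm g hg w hvw
    exact ⟨h, hh, Or.inl h1⟩

end Local

/-! ### Discrete normal subgroups act freely on vertices -/

section Free

variable {V Λ : Type*} {T : SimpleGraph V} [Group Λ]

/-- If the local group at `v` of a normal subgroup `Q` of a dense group is not trivial, then it is
transitive. -/
theorem exists_mem_normal_apply_eq {G : Subgroup (T ≃g T)} (hfin : ∀ x, (T.neighborSet x).Finite)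
    (hqp : IsLocallyQuasiPrimitive G) {ρ : Λ →* (T ≃g T)} (hmem : ∀ l, ρ l ∈ G)
    (hdense : ∀ g ∈ G, ∀ F : Set V, F.Finite → ∃ l, ∀ v ∈ F, ρ l v = g v)
    {Q : Subgroup Λ} (hQn : Q.Normal) {v : V} (hv : localGroup (Q.map ρ) v ≠ ⊥) {w w' : V}
    (hw : T.Adj v w) (hw' : T.Adj v w') : ∃ s ∈ Q, ρ s v = v ∧ ρ s w = w' := by
  have hle : Q.map ρ ≤ G := by
    rintro _ ⟨q, -, rfl⟩
    exact hmem q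
  obtain ⟨σ, hσ, h1⟩ := (hqp v).exists_apply_eq (localGroup_mono hle v) (fun τ hτ σ hσ => by
    obtain ⟨g, hg, hgv, hτg⟩ := mem_localGroup_iff.1 hτ
    obtain ⟨l, hl⟩ := hdense g hg _ ((hfin v).union (Set.finite_singleton v))
    refine conj_mem_localGroup (g := ρ l) ((hl v (Or.inr rfl)).trans hgv) ?_
      (fun u => (hτg u).trans (hl u (Or.inl u.2)).symm) hσ
    rintro _ ⟨q, hq, rfl⟩ -
    exact ⟨l * q * l⁻¹, hQn.conj_mem q hq l, by simp⟩) hv ⟨w, hw⟩ ⟨w', hw'⟩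
  obtain ⟨_, ⟨q, hq, rfl⟩, hqv, hσq⟩ := mem_localGroup_iff.1 hσ
  exact ⟨q, hq, hqv, by rw [← hσq ⟨w, hw⟩, h1]⟩

/-- If `Q` is transitive on the edges at each neighbour of `y`, then an element commuting with the
elements of `Q` that displace `y` by at most `2` fixes the tree pointwise, as soon as it fixes
`y`: those elements already carry `y` to all vertices at even distance from it. -/
theorem eq_one_of_commute (hT : T.IsTree) {ρ : Λ →* (T ≃g T)} {Q : Subgroup Λ} {y : V}
    (hy : ∀ v, T.Adj y v → ∀ w w', T.Adj v w → T.Adj v w' → ∃ s ∈ Q, ρ s v = v ∧ ρ s w = w')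
    (hdeg : ∀ v a, ∃ b, T.Adj v b ∧ b ≠ a) {k : Λ} (hky : ρ k y = y)
    (hk : ∀ q ∈ Q, T.dist (ρ q y) y ≤ 2 → k * q = q * k) : ρ k = 1 := by
  -- The vertices reached from `y` by elements of `Q` commuting with `k`.
  let O : Set V := {v | ∃ q ∈ Q, k * q = q * k ∧ ρ q y = v}
  have hfix : ∀ v ∈ O, ρ k v = v := by
    rintro _ ⟨q, -, hkq, rfl⟩
    rw [← RelIso.mul_apply, ← map_mul, hkq, map_mul, RelIso.mul_apply, hky]
  have hstep : ∀ u ∈ O, ∀ v, T.Adj u v → ∀ w, T.Adj v w → w ∈ O := by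
    rintro _ ⟨q, hq, hkq, rfl⟩ v huv w hvw
    obtain ⟨v, rfl⟩ := (ρ q).surjective v
    obtain ⟨w, rfl⟩ := (ρ q).surjective w
    rw [(ρ q).map_rel_iff] at huv hvw
    obtain ⟨s, hs, -, hsw⟩ := hy v huv y w huv.symm hvw
    have h2 : T.dist (ρ s y) y ≤ 2 := by
      rw [hsw, SimpleGraph.dist_comm]
      exact SimpleGraph.dist_le (.cons huv (.cons hvw .nil))
    refine ⟨q * s, mul_mem hq hs, ?_, ?_⟩
    · rw [← mul_assoc, hkq, mul_assoc, hk s hs h2, mul_assoc]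
    · rw [map_mul, RelIso.mul_apply, hsw]
  have hO : ∀ v, v ∈ O ∨ ∃ u ∈ O, T.Adj u v := by
    refine hT.connected.induction_adj (x := y) (Or.inl ⟨1, one_mem _, by simp, by simp⟩) ?_
    rintro v w hvw (hv | ⟨u, hu, huv⟩)
    · exact Or.inr ⟨v, hv, hvw⟩
    · exact Or.inl (hstep u hu v huv w hvw)
  refine RelIso.ext fun v => ?_
  rcases hO v with hv | ⟨u, hu, huv⟩
  · exact hfix v hv
  · obtain ⟨b, hvb, hbu⟩ := hdeg v u
    have hb := hstep u hu v huv b hvb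
    have h1 : T.Adj u (ρ k v) := by
      have := (ρ k).map_rel_iff.2 huv
      rwa [hfix u hu] at this
    have h2 : T.Adj (ρ k v) b := by
      have := (ρ k).map_rel_iff.2 hvb
      rwa [hfix b hb] at this
    exact eq_of_adj_of_adj hT hbu.symm h1 h2 huv hvb

/-- Let `Λ` be dense in a locally quasi-primitive group with non-trivial fixators. A normal subgroup
of `Λ` that acts discretely acts freely on the vertices. Otherwise it would be locally transitive
at an end of each edge, and an element of `Λ` fixing a large ball would commute with enough of it
to be trivial. -/
theorem eq_one_of_mem_normal_of_apply_eq (hT : T.IsTree) (hfin : ∀ x, (T.neighborSet x).Finite)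
    {G : Subgroup (T ≃g T)} (hnd : HasNontrivialFixators G) (hne : ∀ x, localGroup G x ≠ ⊥)
    (hqp : IsLocallyQuasiPrimitive G) {ρ : Λ →* (T ≃g T)} (hmem : ∀ l, ρ l ∈ G)
    (hdense : ∀ g ∈ G, ∀ F : Set V, F.Finite → ∃ l, ∀ v ∈ F, ρ l v = g v)
    {Q : Subgroup Λ} (hQn : Q.Normal) {F : Set V} (hF : F.Finite)
    (hQ : ∀ q ∈ Q, (∀ v ∈ F, ρ q v = v) → q = 1)
    {q : Λ} (hq : q ∈ Q) {x : V} (hx : ρ q x = x) : q = 1 := by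
  by_contra hq1
  obtain ⟨v₀, hv₀⟩ : ∃ v, localGroup (Q.map ρ) v ≠ ⊥ := by
    by_contra! h
    refine hq1 (hQ q hq fun v _ => ?_)
    rw [eq_one_of_forall_adj hT.connected hx fun v hv =>
      localGroup_eq_bot_iff.1 (h v) _ ⟨q, hq, rfl⟩ hv]
    rfl
  obtain ⟨y, hy⟩ := exists_adj_of_localGroup_ne_bot (hne v₀)
  have hyt : ∀ v, T.Adj y v → ∀ w w', T.Adj v w → T.Adj v w' →
      ∃ s ∈ Q, ρ s v = v ∧ ρ s w = w' := by
    intro v hyv w w' hw hw'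
    obtain ⟨g, hg, -, hgv⟩ := hqp.exists_apply_eq (hne y) hy.symm hyv
    obtain ⟨l, hl⟩ := hdense g hg {v₀} (Set.finite_singleton v₀)
    have hlv : ρ l v₀ = v := (hl v₀ rfl).trans hgv
    subst hlv
    obtain ⟨w, rfl⟩ := (ρ l).surjective w
    obtain ⟨w', rfl⟩ := (ρ l).surjective w'
    rw [(ρ l).map_rel_iff] at hw hw'
    obtain ⟨s, hs, hsv, hsw⟩ := exists_mem_normal_apply_eq hfin hqp hmem hdense hQn hv₀ hw hw'
    refine ⟨l * s * l⁻¹, hQn.conj_mem s hs l, ?_, ?_⟩ <;>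
      simp [RelIso.mul_apply, hsv, hsw]
  obtain ⟨m, hm⟩ := exists_subset_setOf_dist_le y hF (T := T)
  have hk : ∀ k : Λ, (∀ v, T.dist y v ≤ m + 2 → ρ k v = v) → ρ k = 1 := by
    intro k hk
    refine eq_one_of_commute hT hyt (fun v a => exists_adj_ne_of_localGroup_ne_bot (hne v) a)
      (hk y (by simp)) fun s hs hsy => ?_
    -- The commutator lies in `Q` and still fixes the ball of radius `m`, which contains `F`.
    have h1 : k * s * k⁻¹ * s⁻¹ = 1 := by
      refine hQ _ (mul_mem (hQn.conj_mem s hs k) (inv_mem hs)) fun v hv => ?_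
      have h2 : ρ k ((ρ s)⁻¹ v) = (ρ s)⁻¹ v := by
        apply hk
        rw [← dist_apply_apply (ρ s), RelIso.apply_inv_self]
        have := hT.connected.dist_triangle (u := ρ s y) (v := y) (w := v)
        have := hm v hv
        omega
      simp only [map_mul, map_inv, RelIso.mul_apply]
      rw [inv_apply_eq_self h2, RelIso.apply_inv_self]
      exact hk v ((hm v hv).trans (by omega))
    exact mul_inv_eq_iff_eq_mul.1 (mul_inv_eq_one.1 h1)
  have hball := finite_setOf_dist_le hT.connected hfin y (m + 2)
  obtain ⟨g, hg, hg1, hgb⟩ := hnd _ hball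
  refine hg1 (RelIso.ext fun v => ?_)
  obtain ⟨l, hl⟩ := hdense g hg _ (hball.union (Set.finite_singleton v))
  rw [← hl v (Or.inr rfl), hk l fun w hw => (hl w (Or.inl hw)).trans (hgb w hw)]

end Free

/-! ### Sections of finite groups fixing a star -/

section Star

variable {V : Type*} {T : SimpleGraph V}

/-- A simple section of a finite group acting faithfully on a tree and fixing a star pointwise is
a section of a point stabilizer in a local group. A subgroup `L` that is minimal among those mapping
onto `M` acts non-trivially on the edges at some vertex `v` it fixes together with a
neighbour, and by minimality the kernel of this action does not map onto `M`. Minimality takes the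
form of an induction on a bound `n` for the order. -/
theorem exists_isSection_stabilizer (hT : T.Connected) {G : Subgroup (T ≃g T)} {x : V}
    {M : Type*} [Group M] [IsSimpleGroup M] (n : ℕ) :
    ∀ {P : Type*} [Group P] [Finite P], Nat.card P ≤ n → ∀ (ρ : P →* (T ≃g T)),
    Function.Injective ρ → (∀ p, ρ p ∈ G) → (∀ p, ρ p x = x) →
    (∃ w, T.Adj x w ∧ ∀ p, ρ p w = w) → ∀ f : P →* M, Function.Surjective f →
    ∃ (v : V) (e : T.neighborSet v), IsSection M (MulAction.stabilizer (localGroup G v) e) := by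
  induction n with
  | zero =>
    intro P _ _ hn
    exact absurd hn (by have := Nat.card_pos (α := P); omega)
  | succ n ih =>
    intro P _ _ hn ρ hρ hmem hx ⟨w₀, hw₀, hw₀f⟩ f hf
    obtain ⟨v, e, w, hv, he, hw, p₀, hp₀⟩ : ∃ v e w, (∀ p, ρ p v = v) ∧
        (T.Adj v e ∧ ∀ p, ρ p e = e) ∧ T.Adj v w ∧ ∃ p, ρ p w ≠ w := by
      by_contra! h
      have hall : ∀ v, (∀ p, ρ p v = v) ∧ ∃ e, T.Adj v e ∧ ∀ p, ρ p e = e := by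
        refine hT.induction_adj (x := x) ⟨hx, w₀, hw₀, hw₀f⟩ ?_
        rintro v w hvw ⟨hv, e, he⟩
        exact ⟨h v e w hv he hvw, v, hvw.symm, hv⟩
      obtain ⟨m, hm⟩ := exists_ne (1 : M)
      obtain ⟨p, rfl⟩ := hf m
      refine hm ?_
      rw [hρ (show ρ p = ρ 1 from RelIso.ext fun v => by rw [(hall v).1 p, map_one]; rfl), map_one]
    let φ : P →* MulAction.stabilizer (localGroup G v) (⟨e, he.1⟩ : T.neighborSet v) :=
      (((localAction T v).comp (ρ.codRestrict _ hv)).codRestrict (localGroup G v)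
        (fun p => localAction_mem_localGroup (hmem p) (hv p))).codRestrict _
        (fun p => Subtype.ext (he.2 p))
    rcases (Subgroup.Normal.map (inferInstance : φ.ker.Normal) f hf).eq_bot_or_eq_top with h | h
    · refine ⟨v, ⟨e, he.1⟩, IsSection.of_ker_le φ f hf ?_⟩
      exact (Subgroup.map_eq_bot_iff _).1 h
    · have hlt : φ.ker ≠ ⊤ := by
        intro htop
        have h1 : φ p₀ = 1 := by
          rw [← MonoidHom.mem_ker, htop]
          trivial
        exact hp₀ (congrArg
          (fun z : MulAction.stabilizer (localGroup G v) (⟨e, he.1⟩ : T.neighborSet v) =>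
            ((z.1.1 ⟨w, hw⟩ : T.neighborSet v) : V)) h1)
      refine ih (P := φ.ker) ?_ (ρ.comp φ.ker.subtype) (hρ.comp φ.ker.subtype_injective)
        (fun p => hmem p) (fun p => hx p) ⟨w₀, hw₀, fun p => hw₀f p⟩ (f.comp φ.ker.subtype) ?_
      · have := mt (Subgroup.eq_top_of_le_card φ.ker) hlt
        omega
      · intro m
        obtain ⟨p, hp, rfl⟩ : m ∈ φ.ker.map f := h ▸ Subgroup.mem_top m
        exact ⟨⟨p, hp⟩, rfl⟩

end Star

/-! ### Discrete groups with dense projections -/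

section Pair

variable {V₁ V₂ Λ : Type*} {T₁ : SimpleGraph V₁} {T₂ : SimpleGraph V₂} [Group Λ]

/-- A group `Λ` acting on two graphs through a discrete subgroup of `G₁ × G₂` whose projections to
`G₁` and `G₂` are dense. Discreteness and density refer to the topology of pointwise convergence,
and are expressed by finite sets of vertices; discreteness includes that `Λ` acts faithfully on
the product. -/
structure IsDiscreteDensePair (G₁ : Subgroup (T₁ ≃g T₁)) (G₂ : Subgroup (T₂ ≃g T₂))
    (ρ₁ : Λ →* (T₁ ≃g T₁)) (ρ₂ : Λ →* (T₂ ≃g T₂)) : Prop where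
  mem₁ : ∀ l, ρ₁ l ∈ G₁
  mem₂ : ∀ l, ρ₂ l ∈ G₂
  dense₁ : ∀ g ∈ G₁, ∀ F : Set V₁, F.Finite → ∃ l, ∀ v ∈ F, ρ₁ l v = g v
  dense₂ : ∀ g ∈ G₂, ∀ F : Set V₂, F.Finite → ∃ l, ∀ v ∈ F, ρ₂ l v = g v
  discrete : ∃ (F₁ : Set V₁) (F₂ : Set V₂), F₁.Finite ∧ F₂.Finite ∧
    ∀ l, (∀ v ∈ F₁, ρ₁ l v = v) → (∀ v ∈ F₂, ρ₂ l v = v) → l = 1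

theorem IsDiscreteDensePair.symm {G₁ : Subgroup (T₁ ≃g T₁)} {G₂ : Subgroup (T₂ ≃g T₂)}
    {ρ₁ : Λ →* (T₁ ≃g T₁)} {ρ₂ : Λ →* (T₂ ≃g T₂)} (h : IsDiscreteDensePair G₁ G₂ ρ₁ ρ₂) :
    IsDiscreteDensePair G₂ G₁ ρ₂ ρ₁ := by
  obtain ⟨F₁, F₂, h₁, h₂, h₃⟩ := h.discrete
  exact ⟨h.mem₂, h.mem₁, h.dense₂, h.dense₁, F₂, F₁, h₂, h₁, fun l hl hl' => h₃ l hl' hl⟩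

/-- The only element acting trivially on one tree and fixing a vertex of the other is `1`. -/
theorem IsDiscreteDensePair.eq_one {G₁ : Subgroup (T₁ ≃g T₁)} {G₂ : Subgroup (T₂ ≃g T₂)}
    {ρ₁ : Λ →* (T₁ ≃g T₁)} {ρ₂ : Λ →* (T₂ ≃g T₂)} (h : IsDiscreteDensePair G₁ G₂ ρ₁ ρ₂)
    (hT₂ : T₂.IsTree) (hfin₂ : ∀ x, (T₂.neighborSet x).Finite) (hnd₂ : HasNontrivialFixators G₂)
    (hne₂ : ∀ x, localGroup G₂ x ≠ ⊥) (hqp₂ : IsLocallyQuasiPrimitive G₂) {l : Λ}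
    (hl : ρ₁ l = 1) {x : V₂} (hx : ρ₂ l x = x) : l = 1 := by
  obtain ⟨F₁, F₂, -, h₂, h₃⟩ := h.discrete
  refine eq_one_of_mem_normal_of_apply_eq hT₂ hfin₂ hnd₂ hne₂ hqp₂ h.mem₂ h.dense₂
    (Q := ρ₁.ker) inferInstance h₂ (fun q hq hqF => h₃ q (fun v _ => ?_) hqF) hl hx
  rw [MonoidHom.mem_ker.1 hq]
  rfl

theorem IsDiscreteDensePair.finite {G₁ : Subgroup (T₁ ≃g T₁)} {G₂ : Subgroup (T₂ ≃g T₂)}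
    {ρ₁ : Λ →* (T₁ ≃g T₁)} {ρ₂ : Λ →* (T₂ ≃g T₂)} (h : IsDiscreteDensePair G₁ G₂ ρ₁ ρ₂)
    (hT₁ : T₁.Connected) (hT₂ : T₂.Connected) (hfin₁ : ∀ x, (T₁.neighborSet x).Finite)
    (hfin₂ : ∀ x, (T₂.neighborSet x).Finite) {P : Subgroup Λ} {x₁ : V₁} {x₂ : V₂}
    (hx₁ : ∀ p ∈ P, ρ₁ p x₁ = x₁) (hx₂ : ∀ p ∈ P, ρ₂ p x₂ = x₂) : Finite P := by
  obtain ⟨F₁, F₂, h₁, h₂, h₃⟩ := h.discrete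
  obtain ⟨m₁, hm₁⟩ := exists_subset_setOf_dist_le x₁ h₁ (T := T₁)
  obtain ⟨m₂, hm₂⟩ := exists_subset_setOf_dist_le x₂ h₂ (T := T₂)
  have hB₁ := finite_setOf_dist_le hT₁ hfin₁ x₁ m₁
  have hB₂ := finite_setOf_dist_le hT₂ hfin₂ x₂ m₂
  have := hB₁.to_subtype
  have := hB₂.to_subtype
  -- `P` acts faithfully on two finite balls.
  let φ : P → ({v | T₁.dist x₁ v ≤ m₁} → {v | T₁.dist x₁ v ≤ m₁}) ×
      ({v | T₂.dist x₂ v ≤ m₂} → {v | T₂.dist x₂ v ≤ m₂}) := fun p =>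
    (fun v => ⟨ρ₁ p v, by
      have := dist_apply_apply (ρ₁ p) x₁ v
      rw [hx₁ p p.2] at this
      exact this.trans_le v.2⟩,
     fun v => ⟨ρ₂ p v, by
      have := dist_apply_apply (ρ₂ p) x₂ v
      rw [hx₂ p p.2] at this
      exact this.trans_le v.2⟩)
  refine Finite.of_injective φ fun p q hpq => ?_
  have h4 : (q : Λ)⁻¹ * p = 1 := by
    refine h₃ _ (fun v hv => ?_) (fun v hv => ?_)
    · have h5 : ρ₁ p v = ρ₁ q v :=
        congrArg Subtype.val (congrFun (congrArg Prod.fst hpq) ⟨v, hm₁ v hv⟩)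
      rw [map_mul, map_inv, RelIso.mul_apply, h5, RelIso.inv_apply_self]
    · have h5 : ρ₂ p v = ρ₂ q v :=
        congrArg Subtype.val (congrFun (congrArg Prod.snd hpq) ⟨v, hm₂ v hv⟩)
      rw [map_mul, map_inv, RelIso.mul_apply, h5, RelIso.inv_apply_self]
  exact Subtype.ext (inv_mul_eq_one.1 h4).symm

/-- The elements of `Λ` that fix the vertex `x₁` of the first graph and the ball of radius `r`
around the vertex `x₂` of the second. -/
def vertexBallFixator (ρ₁ : Λ →* (T₁ ≃g T₁)) (ρ₂ : Λ →* (T₂ ≃g T₂)) (x₁ : V₁) (x₂ : V₂) (r : ℕ) :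
    Subgroup Λ where
  carrier := {l | ρ₁ l x₁ = x₁ ∧ ∀ v, T₂.dist x₂ v ≤ r → ρ₂ l v = v}
  one_mem' := by simp
  mul_mem' := by
    rintro a b ⟨ha, ha'⟩ ⟨hb, hb'⟩
    refine ⟨by rw [map_mul, RelIso.mul_apply, hb, ha], fun v hv => ?_⟩
    rw [map_mul, RelIso.mul_apply, hb' v hv, ha' v hv]
  inv_mem' := by
    rintro a ⟨ha, ha'⟩
    refine ⟨by rw [map_inv, inv_apply_eq_self ha], fun v hv => ?_⟩
    rw [map_inv, inv_apply_eq_self (ha' v hv)]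

theorem vertexBallFixator_anti (ρ₁ : Λ →* (T₁ ≃g T₁)) (ρ₂ : Λ →* (T₂ ≃g T₂)) (x₁ : V₁) (x₂ : V₂) :
    Antitone (vertexBallFixator ρ₁ ρ₂ x₁ x₂) :=
  fun _ _ hrs _ hl => ⟨hl.1, fun v hv => hl.2 v (hv.trans hrs)⟩

/-- A decreasing sequence of subgroups of a finite group repeats a term. -/
theorem exists_lt_succ_eq {G : Type*} [Group G] [Finite G] {A : ℕ → Subgroup G} (hA : Antitone A)
    {N : ℕ} (hN : Nat.card G ≤ N) : ∃ i < N, A (i + 1) = A i := by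
  by_contra! h
  have key : ∀ i ≤ N, Nat.card (A i) + i ≤ Nat.card G := by
    intro i
    induction i with
    | zero => exact fun _ => Subgroup.card_le_card_group _
    | succ i ih =>
      intro hi
      have h1 := ih (by omega)
      have h2 : Nat.card (A (i + 1)) < Nat.card (A i) := by
        by_contra! h3
        exact h i (by omega) (Subgroup.eq_of_le_of_card_ge (hA (Nat.le_succ i)) h3)
      omega
  have h1 := key N le_rfl
  have h2 : 0 < Nat.card (A N) := Nat.card_pos
  omega

/-- Suppose that elements of `Λ` fixing `x₁` and displacing `x₂` by at most `D` induce the whole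
local group at `x₁`. Conjugation by them changes the radius in `vertexBallFixator` by at most `D`,
so at a radius where the local group of this fixator does not change over a step of length `D`, it
is normalized by the whole local group. -/
theorem conj_mem_localGroup_vertexBallFixator (hT₂ : T₂.Connected) {G₁ : Subgroup (T₁ ≃g T₁)}
    {ρ₁ : Λ →* (T₁ ≃g T₁)} {ρ₂ : Λ →* (T₂ ≃g T₂)} {x₁ : V₁} {x₂ : V₂} {D r : ℕ}
    (hD : ∀ g ∈ G₁, g x₁ = x₁ → ∃ l, ρ₁ l x₁ = x₁ ∧ (∀ w, T₁.Adj x₁ w → ρ₁ l w = g w) ∧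
      T₂.dist (ρ₂ l x₂) x₂ ≤ D)
    {τ : Equiv.Perm (T₁.neighborSet x₁)} (hτ : τ ∈ localGroup G₁ x₁)
    {σ : Equiv.Perm (T₁.neighborSet x₁)}
    (hσ : σ ∈ localGroup ((vertexBallFixator ρ₁ ρ₂ x₁ x₂ (r + D)).map ρ₁) x₁) :
    τ * σ * τ⁻¹ ∈ localGroup ((vertexBallFixator ρ₁ ρ₂ x₁ x₂ r).map ρ₁) x₁ := by
  obtain ⟨g, hg, hgx, hτg⟩ := mem_localGroup_iff.1 hτ
  obtain ⟨l, hlx, hlg, hlD⟩ := hD g hg hgx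
  refine conj_mem_localGroup hlx ?_ (fun w => (hτg w).trans (hlg w w.2).symm) hσ
  rintro _ ⟨k, ⟨hk₁, hk₂⟩, rfl⟩ -
  refine ⟨l * k * l⁻¹, ⟨?_, fun v hv => ?_⟩, by simp⟩
  · simp only [map_mul, map_inv, RelIso.mul_apply]
    rw [inv_apply_eq_self hlx, hk₁, hlx]
  · simp only [map_mul, map_inv, RelIso.mul_apply]
    rw [hk₂, RelIso.apply_inv_self]
    rw [← dist_apply_apply (ρ₂ l), RelIso.apply_inv_self]
    have := hT₂.dist_triangle (u := ρ₂ l x₂) (v := x₂) (w := v)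
    omega

/-- The quantitative form of the theorem, in one direction: an element of `Λ` other than `1` cannot
fix a vertex of `T₁` and a ball of `T₂` of radius `1 + N * D`, unless the simple factors for `G₁`
are sections of the point stabilizers for `G₂`. Here `D` bounds the displacement of `x₂` by elements
inducing the local groups on `T₁`, and `N` bounds the orders of these local groups. -/
theorem IsDiscreteDensePair.isSection {G₁ : Subgroup (T₁ ≃g T₁)} {G₂ : Subgroup (T₂ ≃g T₂)}
    {ρ₁ : Λ →* (T₁ ≃g T₁)} {ρ₂ : Λ →* (T₂ ≃g T₂)} (h : IsDiscreteDensePair G₁ G₂ ρ₁ ρ₂)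
    (hT₁ : T₁.IsTree) (hT₂ : T₂.IsTree)
    (hfin₁ : ∀ x, (T₁.neighborSet x).Finite) (hfin₂ : ∀ x, (T₂.neighborSet x).Finite)
    (hnd₁ : HasNontrivialFixators G₁) (hnd₂ : HasNontrivialFixators G₂)
    (hct₁ : IsConstantType G₁) (hct₂ : IsConstantType G₂)
    (hqp₁ : IsLocallyQuasiPrimitive G₁) (hqp₂ : IsLocallyQuasiPrimitive G₂)
    {N : ℕ} (hN : ∀ x₁, Nat.card (Equiv.Perm (T₁.neighborSet x₁)) ≤ N)
    {x₂ : V₂} {D : ℕ}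
    (hD : ∀ x₁, ∀ g ∈ G₁, g x₁ = x₁ → ∃ l, ρ₁ l x₁ = x₁ ∧ (∀ w, T₁.Adj x₁ w → ρ₁ l w = g w) ∧
      T₂.dist (ρ₂ l x₂) x₂ ≤ D)
    {l : Λ} (hl : l ≠ 1) {x₁ : V₁} (hlx₁ : ρ₁ l x₁ = x₁)
    (hlx₂ : ∀ v, T₂.dist x₂ v ≤ 1 + N * D → ρ₂ l v = v)
    (a₁ : V₁) (N₁ M₁ : Subgroup (localGroup G₁ a₁)) (hN₁ : IsMinimalNormalSubgroup N₁)
    (hM₁ : IsSimpleFactor M₁ N₁) (a₂ : V₂) (e₂ : T₂.neighborSet a₂) :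
    IsSection M₁ (MulAction.stabilizer (localGroup G₂ a₂) e₂) := by
  have hne₁ := localGroup_ne_bot hT₁.connected hnd₁ hct₁
  have hne₂ := localGroup_ne_bot hT₂.connected hnd₂ hct₂
  obtain ⟨y, hy⟩ : ∃ y, localGroup ((vertexBallFixator ρ₁ ρ₂ y x₂ (1 + N * D)).map ρ₁) y ≠ ⊥ := by
    by_contra! h0
    refine hl (h.eq_one hT₂ hfin₂ hnd₂ hne₂ hqp₂ ?_ (hlx₂ x₂ (by simp)))
    exact eq_one_of_forall_adj hT₁.connected hlx₁ fun v hv =>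
      localGroup_eq_bot_iff.1 (h0 v) _ ⟨l, ⟨hv, hlx₂⟩, rfl⟩ hv
  let P : ℕ → Subgroup Λ := fun i => vertexBallFixator ρ₁ ρ₂ y x₂ (1 + i * D)
  let A : ℕ → Subgroup (Equiv.Perm (T₁.neighborSet y)) := fun i => localGroup ((P i).map ρ₁) y
  have hA : Antitone A := fun i j hij => localGroup_mono (Subgroup.map_mono
    (vertexBallFixator_anti ρ₁ ρ₂ y x₂ (by gcongr))) y
  have := (hfin₁ y).to_subtype
  obtain ⟨i, hi, hAi⟩ := exists_lt_succ_eq hA (hN y)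
  have hAne : A i ≠ ⊥ := fun h0 => hy (le_bot_iff.1 (h0 ▸ hA hi.le))
  have hAG : A i ≤ localGroup G₁ y := by
    refine localGroup_mono ?_ y
    rintro _ ⟨q, -, rfl⟩
    exact h.mem₁ q
  have hAn : ∀ τ ∈ localGroup G₁ y, ∀ σ ∈ A i, τ * σ * τ⁻¹ ∈ A i := by
    intro τ hτ σ hσ
    rw [← hAi] at hσ
    refine conj_mem_localGroup_vertexBallFixator hT₂.connected (hD y) hτ ?_
    rwa [show 1 + i * D + D = 1 + (i + 1) * D by ring]
  have hMA : IsSection M₁ (A i) := (hct₁.permGroupIso a₁ y).isSection_of_isSimpleFactor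
    (hqp₁ a₁) hN₁ hM₁ hAG hAn hAne
  let π : P i →* A i := ((localAction T₁ y).comp
    ((ρ₁.comp (P i).subtype).codRestrict (MulAction.stabilizer (T₁ ≃g T₁) y)
      fun p => p.2.1)).codRestrict (A i) fun p =>
        localAction_mem_localGroup (H := (P i).map ρ₁) ⟨p.1, p.2, rfl⟩ p.2.1
  have hπ : Function.Surjective π := by
    rintro ⟨σ, hσ⟩
    obtain ⟨_, ⟨p, hp, rfl⟩, -, hσp⟩ := mem_localGroup_iff.1 hσ
    exact ⟨⟨p, hp⟩, Subtype.ext (Equiv.ext fun w => Subtype.ext (hσp w).symm)⟩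
  obtain ⟨L, f, hf⟩ := (hMA.of_surjective π hπ).exists_surjective
  have hfixP : ∀ p ∈ P i, ∀ v, T₂.dist x₂ v ≤ 1 → ρ₂ p v = v :=
    fun p hp v hv => hp.2 v (hv.trans (by omega))
  have : Finite (P i) := h.finite hT₁.connected hT₂.connected hfin₁ hfin₂ (x₁ := y) (x₂ := x₂)
    (fun p hp => hp.1) fun p hp => hfixP p hp x₂ (by simp)
  have : IsSimpleGroup M₁ := hM₁.1
  obtain ⟨w, hw⟩ := exists_adj_of_localGroup_ne_bot (hne₂ x₂)
  have hinj : Function.Injective (ρ₂.comp ((P i).subtype.comp L.subtype)) := by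
    rw [injective_iff_map_eq_one]
    intro p hp
    have h1 : (p.1.1 : Λ) = 1 := h.symm.eq_one hT₁ hfin₁ hnd₁ hne₁ hqp₁ hp p.1.2.1
    exact Subtype.ext (Subtype.ext h1)
  obtain ⟨v, e, hve⟩ := exists_isSection_stabilizer hT₂.connected (G := G₂) (x := x₂) _ le_rfl
    (ρ₂.comp ((P i).subtype.comp L.subtype)) hinj (fun p => h.mem₂ _)
    (fun p => hfixP _ p.1.2 x₂ (by simp))
    ⟨w, hw, fun p => hfixP _ p.1.2 w (by rw [SimpleGraph.dist_eq_one_iff_adj.2 hw])⟩ f hf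
  exact (hct₂.permGroupIso v a₂).isSection_stabilizer e e₂
    (fun b => hqp₂.exists_localGroup_apply_eq (hne₂ a₂) b e₂) hve

end Pair

/-! ### Displacements and cocompactness -/

section Displacement

variable {V₁ V₂ Λ : Type*} {T₁ : SimpleGraph V₁} {T₂ : SimpleGraph V₂} [Group Λ]

/-- The combinatorial content of cocompactness of `Λ` in `G₁ × G₂`: each exhaustion of the set of
pairs of vertices by `Λ`-invariant sets reaches all of a given `G₁ × G₂`-orbit after finitely many
steps. -/
def BoundedOnOrbits (G₁ : Subgroup (T₁ ≃g T₁)) (G₂ : Subgroup (T₂ ≃g T₂))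
    (ρ₁ : Λ →* (T₁ ≃g T₁)) (ρ₂ : Λ →* (T₂ ≃g T₂)) : Prop :=
  ∀ (a₁ : V₁) (a₂ : V₂) (p : ℕ → V₁ → V₂ → Prop), (∀ m n v w, m ≤ n → p m v w → p n v w) →
    (∀ n l v w, p n v w → p n (ρ₁ l v) (ρ₂ l w)) → (∀ v w, ∃ n, p n v w) →
    ∃ n, ∀ g₁ ∈ G₁, ∀ g₂ ∈ G₂, p n (g₁ a₁) (g₂ a₂)

theorem BoundedOnOrbits.symm {G₁ : Subgroup (T₁ ≃g T₁)} {G₂ : Subgroup (T₂ ≃g T₂)}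
    {ρ₁ : Λ →* (T₁ ≃g T₁)} {ρ₂ : Λ →* (T₂ ≃g T₂)} (h : BoundedOnOrbits G₁ G₂ ρ₁ ρ₂) :
    BoundedOnOrbits G₂ G₁ ρ₂ ρ₁ := by
  intro a₂ a₁ p hp₁ hp₂ hp₃
  obtain ⟨n, hn⟩ := h a₁ a₂ (fun n v w => p n w v) (fun m n v w => hp₁ m n w v)
    (fun n l v w => hp₂ n l w v) (fun v w => hp₃ w v)
  exact ⟨n, fun g₂ h₂ g₁ h₁ => hn g₁ h₁ g₂ h₂⟩

/-- By density, `Λ` induces the whole local groups of `G₁`; by cocompactness, this is done by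
elements whose displacement of `x₂` is bounded independently of the vertex of `T₁`. -/
theorem BoundedOnOrbits.exists_displacement_bound {G₁ : Subgroup (T₁ ≃g T₁)}
    {G₂ : Subgroup (T₂ ≃g T₂)} {ρ₁ : Λ →* (T₁ ≃g T₁)} {ρ₂ : Λ →* (T₂ ≃g T₂)}
    (h : BoundedOnOrbits G₁ G₂ ρ₁ ρ₂) (hT₁ : T₁.Connected)
    (hfin₁ : ∀ x, (T₁.neighborSet x).Finite)
    (hne₁ : ∀ x, localGroup G₁ x ≠ ⊥) (hqp₁ : IsLocallyQuasiPrimitive G₁)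
    (hmem₁ : ∀ l, ρ₁ l ∈ G₁)
    (hdense₁ : ∀ g ∈ G₁, ∀ F : Set V₁, F.Finite → ∃ l, ∀ v ∈ F, ρ₁ l v = g v) (x₂ : V₂) :
    ∃ D, ∀ x₁, ∀ g ∈ G₁, g x₁ = x₁ → ∃ l, ρ₁ l x₁ = x₁ ∧
      (∀ w, T₁.Adj x₁ w → ρ₁ l w = g w) ∧ T₂.dist (ρ₂ l x₂) x₂ ≤ D := by
  let p : ℕ → V₁ → V₂ → Prop := fun n v w => ∀ g ∈ G₁, g v = v → ∃ l, ρ₁ l v = v ∧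
    (∀ u, T₁.Adj v u → ρ₁ l u = g u) ∧ T₂.dist (ρ₂ l w) w ≤ n
  have hp₁ : ∀ m n v w, m ≤ n → p m v w → p n v w := by
    intro m n v w hmn hm g hg hgv
    obtain ⟨l, h1, h2, h3⟩ := hm g hg hgv
    exact ⟨l, h1, h2, h3.trans hmn⟩
  have hp₂ : ∀ n l v w, p n v w → p n (ρ₁ l v) (ρ₂ l w) := by
    intro n k v w hn g hg hgv
    obtain ⟨l, h1, h2, h3⟩ := hn ((ρ₁ k)⁻¹ * g * ρ₁ k)
      (mul_mem (mul_mem (inv_mem (hmem₁ k)) hg) (hmem₁ k))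
      (by simp only [RelIso.mul_apply, hgv, RelIso.inv_apply_self])
    refine ⟨k * l * k⁻¹, ?_, fun u hu => ?_, ?_⟩
    · simp only [map_mul, map_inv, RelIso.mul_apply, RelIso.inv_apply_self, h1]
    · obtain ⟨u, rfl⟩ := (ρ₁ k).surjective u
      rw [(ρ₁ k).map_rel_iff] at hu
      simp only [map_mul, map_inv, RelIso.mul_apply, RelIso.inv_apply_self, h2 u hu,
        RelIso.apply_inv_self]
    · simp only [map_mul, map_inv, RelIso.mul_apply, RelIso.inv_apply_self]
      rwa [dist_apply_apply]
  have hp₃ : ∀ v w, ∃ n, p n v w := by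
    intro v w
    have := (hfin₁ v).to_subtype
    have hl : ∀ σ : localGroup G₁ v, ∃ l, ρ₁ l v = v ∧
        ∀ u : T₁.neighborSet v, ρ₁ l u = (σ.1 u : V₁) := by
      rintro ⟨σ, hσ⟩
      obtain ⟨g, hg, hgv, hσg⟩ := mem_localGroup_iff.1 hσ
      obtain ⟨l, hl⟩ := hdense₁ g hg _ ((hfin₁ v).union (Set.finite_singleton v))
      exact ⟨l, (hl v (Or.inr rfl)).trans hgv, fun u =>
        (hl u (Or.inl u.2)).trans (hσg u).symm⟩
    choose l hl₁ hl₂ using hl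
    obtain ⟨n, hn⟩ := (Set.finite_range fun σ => T₂.dist (ρ₂ (l σ) w) w).bddAbove
    refine ⟨n, fun g hg hgv => ?_⟩
    obtain ⟨σ, hσ, hσg⟩ := exists_mem_localGroup hg hgv
    exact ⟨l ⟨σ, hσ⟩, hl₁ _, fun u hu => (hl₂ ⟨σ, hσ⟩ ⟨u, hu⟩).trans (hσg _), hn ⟨_, rfl⟩⟩
  obtain ⟨a⟩ := hT₁.nonempty
  obtain ⟨b, hab⟩ := exists_adj_of_localGroup_ne_bot (hne₁ a)
  obtain ⟨m, hm⟩ := h a x₂ p hp₁ hp₂ hp₃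
  obtain ⟨n, hn⟩ := h b x₂ p hp₁ hp₂ hp₃
  refine ⟨max m n, fun x₁ => ?_⟩
  obtain ⟨g, hg, rfl | rfl⟩ := exists_apply_eq_or hT₁ hqp₁ hne₁ hab x₁
  · exact hp₁ _ _ _ _ (le_max_left _ _) (hm g hg 1 (one_mem _))
  · exact hp₁ _ _ _ _ (le_max_right _ _) (hn g hg 1 (one_mem _))

/-- For a dense and cocompact `Γ` there is a radius `R` such that a discrete group containing `Γ`
has no element other than `1` fixing a vertex of `T₁` and the ball of radius `R` around `x₂`, unless
the simple factors for `G₁` are sections of the point stabilizers for `G₂`. The radius does not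
depend on the discrete group `Λ`. -/
theorem BoundedOnOrbits.exists_radius {Γ : Type*} [Group Γ] {G₁ : Subgroup (T₁ ≃g T₁)}
    {G₂ : Subgroup (T₂ ≃g T₂)} {ρ₁ : Γ →* (T₁ ≃g T₁)} {ρ₂ : Γ →* (T₂ ≃g T₂)}
    (h : BoundedOnOrbits G₁ G₂ ρ₁ ρ₂) (hT₁ : T₁.IsTree) (hT₂ : T₂.IsTree)
    (hfin₁ : ∀ x, (T₁.neighborSet x).Finite) (hfin₂ : ∀ x, (T₂.neighborSet x).Finite)
    (hnd₁ : HasNontrivialFixators G₁) (hnd₂ : HasNontrivialFixators G₂)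
    (hct₁ : IsConstantType G₁) (hct₂ : IsConstantType G₂)
    (hqp₁ : IsLocallyQuasiPrimitive G₁) (hqp₂ : IsLocallyQuasiPrimitive G₂)
    (hmem₁ : ∀ l, ρ₁ l ∈ G₁)
    (hdense₁ : ∀ g ∈ G₁, ∀ F : Set V₁, F.Finite → ∃ l, ∀ v ∈ F, ρ₁ l v = g v) (x₂ : V₂) :
    ∃ R, ∀ {Λ : Type*} [Group Λ] (i : Γ →* Λ) (σ₁ : Λ →* (T₁ ≃g T₁)) (σ₂ : Λ →* (T₂ ≃g T₂)),
      σ₁.comp i = ρ₁ → σ₂.comp i = ρ₂ → IsDiscreteDensePair G₁ G₂ σ₁ σ₂ →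
      ∀ (x₁ : V₁) (l : Λ), l ≠ 1 → σ₁ l x₁ = x₁ → (∀ v, T₂.dist x₂ v ≤ R → σ₂ l v = v) →
      ∀ (a₁ : V₁) (N₁ M₁ : Subgroup (localGroup G₁ a₁)), IsMinimalNormalSubgroup N₁ →
      IsSimpleFactor M₁ N₁ → ∀ (a₂ : V₂) (e₂ : T₂.neighborSet a₂),
      IsSection M₁ (MulAction.stabilizer (localGroup G₂ a₂) e₂) := by
  obtain ⟨D, hD⟩ := h.exists_displacement_bound hT₁.connected hfin₁
    (localGroup_ne_bot hT₁.connected hnd₁ hct₁) hqp₁ hmem₁ hdense₁ x₂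
  obtain ⟨a⟩ := hT₁.connected.nonempty
  refine ⟨1 + Nat.card (Equiv.Perm (T₁.neighborSet a)) * D, ?_⟩
  rintro Λ _ i σ₁ σ₂ rfl rfl hΛ x₁ l hl hl₁ hl₂
  refine hΛ.isSection hT₁ hT₂ hfin₁ hfin₂ hnd₁ hnd₂ hct₁ hct₂ hqp₁ hqp₂ (fun y => ?_)
    (fun y g hg hgy => ?_) hl hl₁ hl₂
  · obtain ⟨e, -⟩ := hct₁.permGroupIso y a
    exact (Nat.card_congr e.permCongr).le
  · obtain ⟨k, hk⟩ := hD y g hg hgy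
    exact ⟨i k, hk⟩

end Displacement

/-! ### The topology of pointwise convergence -/

section Topology

variable {V : Type*} {T : SimpleGraph V}

theorem nhds_graphAut_hasBasis (g : T ≃g T) :
    (𝓝 g).HasBasis (fun F : Set V => F.Finite) fun F => {h | ∀ v ∈ F, h v = g v} := by
  have h1 : 𝓝 g = ⨅ x : V, Filter.principal {h : T ≃g T | h x = g x} := by
    rw [show (𝓝 g) = @nhds _ (⨅ x : V, TopologicalSpace.induced (fun g : T ≃g T => g x) ⊥) g
      from rfl, nhds_iInf]
    refine iInf_congr fun x => ?_
    let _ : TopologicalSpace V := ⊥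
    have : DiscreteTopology V := ⟨rfl⟩
    rw [nhds_induced, nhds_discrete, Filter.comap_pure]
    rfl
  rw [h1]
  convert Filter.hasBasis_iInf_principal_finite (fun x : V => {h : T ≃g T | h x = g x}) using 2
  ext h
  simp

theorem mem_nhds_subgroup_iff {G : Subgroup (T ≃g T)} {g : G} {U : Set G} :
    U ∈ 𝓝 g ↔ ∃ F : Set V, F.Finite ∧ ∀ h : G, (∀ v ∈ F, h.1 v = g.1 v) → h ∈ U := by
  rw [nhds_subtype_eq_comap, ((nhds_graphAut_hasBasis g.1).comap _).mem_iff]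
  rfl

theorem hasNontrivialFixators_of_not_discreteTopology {G : Subgroup (T ≃g T)}
    (h : ¬ DiscreteTopology G) : HasNontrivialFixators G := by
  intro F hF
  by_contra! h1
  refine h (discreteTopology_iff_isOpen_singleton.2 fun g => isOpen_iff_mem_nhds.2 ?_)
  intro g' hg'
  rw [Set.mem_singleton_iff.1 hg']
  refine mem_nhds_subgroup_iff.2 ⟨F, hF, fun k hk => ?_⟩
  by_contra hne
  have hk1 : g.1⁻¹ * k.1 ≠ 1 := fun h2 => hne (Subtype.ext (inv_mul_eq_one.1 h2).symm)
  obtain ⟨v, hv, hvne⟩ := h1 _ (mul_mem (inv_mem g.2) k.2) hk1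
  refine hvne ?_
  rw [RelIso.mul_apply, hk v hv, RelIso.inv_apply_self]

/-- Agreement with an element of a dense subgroup on finite sets of vertices. -/
theorem exists_agree_of_dense {G : Subgroup (T ≃g T)} {S : Set G} (hS : Dense S) {g : T ≃g T}
    (hg : g ∈ G) {F : Set V} (hF : F.Finite) : ∃ s ∈ S, ∀ v ∈ F, s.1 v = g v := by
  obtain ⟨s, hs, hsS⟩ := mem_closure_iff_nhds.1 (hS ⟨g, hg⟩) {h | ∀ v ∈ F, h.1 v = g v}
    (mem_nhds_subgroup_iff.2 ⟨F, hF, fun _ h => h⟩)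
  exact ⟨s, hsS, hs⟩

variable {V₁ V₂ : Type*} {T₁ : SimpleGraph V₁} {T₂ : SimpleGraph V₂}
  {G₁ : Subgroup (T₁ ≃g T₁)} {G₂ : Subgroup (T₂ ≃g T₂)}

theorem mem_nhds_prod_subgroup_iff {g : G₁ × G₂} {U : Set (G₁ × G₂)} :
    U ∈ 𝓝 g ↔ ∃ (F₁ : Set V₁) (F₂ : Set V₂), F₁.Finite ∧ F₂.Finite ∧ ∀ h : G₁ × G₂,
      (∀ v ∈ F₁, h.1.1 v = g.1.1 v) → (∀ v ∈ F₂, h.2.1 v = g.2.1 v) → h ∈ U := by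
  rw [nhds_prod_eq, Filter.mem_prod_iff]
  constructor
  · rintro ⟨U₁, h₁, U₂, h₂, hU⟩
    obtain ⟨F₁, hF₁, h₁⟩ := mem_nhds_subgroup_iff.1 h₁
    obtain ⟨F₂, hF₂, h₂⟩ := mem_nhds_subgroup_iff.1 h₂
    exact ⟨F₁, F₂, hF₁, hF₂, fun h hh₁ hh₂ => hU ⟨h₁ _ hh₁, h₂ _ hh₂⟩⟩
  · rintro ⟨F₁, F₂, hF₁, hF₂, hU⟩
    exact ⟨_, mem_nhds_subgroup_iff.2 ⟨F₁, hF₁, fun _ h => h⟩,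
      _, mem_nhds_subgroup_iff.2 ⟨F₂, hF₂, fun _ h => h⟩, fun h hh => hU h hh.1 hh.2⟩

/-- The action on the first graph of a subgroup of `G₁ × G₂`. -/
def fstAction (Γ : Subgroup (G₁ × G₂)) : Γ →* (T₁ ≃g T₁) :=
  G₁.subtype.comp ((MonoidHom.fst G₁ G₂).comp Γ.subtype)

/-- The action on the second graph of a subgroup of `G₁ × G₂`. -/
def sndAction (Γ : Subgroup (G₁ × G₂)) : Γ →* (T₂ ≃g T₂) :=
  G₂.subtype.comp ((MonoidHom.snd G₁ G₂).comp Γ.subtype)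

theorem fstAction_dense {Γ : Subgroup (G₁ × G₂)}
    (hdense : Dense (Γ.map (MonoidHom.fst G₁ G₂) : Set G₁)) :
    ∀ g ∈ G₁, ∀ F : Set V₁, F.Finite → ∃ l, ∀ v ∈ F, fstAction Γ l v = g v := by
  intro g hg F hF
  obtain ⟨_, ⟨l, hl, rfl⟩, h⟩ := exists_agree_of_dense hdense hg hF
  exact ⟨⟨l, hl⟩, h⟩

theorem sndAction_dense {Γ : Subgroup (G₁ × G₂)}
    (hdense : Dense (Γ.map (MonoidHom.snd G₁ G₂) : Set G₂)) :
    ∀ g ∈ G₂, ∀ F : Set V₂, F.Finite → ∃ l, ∀ v ∈ F, sndAction Γ l v = g v := by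
  intro g hg F hF
  obtain ⟨_, ⟨l, hl, rfl⟩, h⟩ := exists_agree_of_dense hdense hg hF
  exact ⟨⟨l, hl⟩, h⟩

theorem isDiscreteDensePair {Λ : Subgroup (G₁ × G₂)} (hΛ : DiscreteTopology Λ)
    (hdense₁ : Dense (Λ.map (MonoidHom.fst G₁ G₂) : Set G₁))
    (hdense₂ : Dense (Λ.map (MonoidHom.snd G₁ G₂) : Set G₂)) :
    IsDiscreteDensePair G₁ G₂ (fstAction Λ) (sndAction Λ) := by
  refine ⟨fun l => l.1.1.2, fun l => l.1.2.2, fstAction_dense hdense₁, sndAction_dense hdense₂, ?_⟩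
  have h1 : ({1} : Set Λ) ∈ 𝓝 (1 : Λ) := (isOpen_discrete _).mem_nhds rfl
  rw [nhds_subtype_eq_comap, Filter.mem_comap] at h1
  obtain ⟨U, hU, hU1⟩ := h1
  obtain ⟨F₁, F₂, hF₁, hF₂, h2⟩ := mem_nhds_prod_subgroup_iff.1 hU
  exact ⟨F₁, F₂, hF₁, hF₂, fun l hl₁ hl₂ => hU1 (h2 l hl₁ hl₂)⟩

/-- In a group with compact quotient by `Γ`, finitely many steps of an exhaustion by open right
`Γ`-invariant sets suffice. -/
theorem exists_forall_of_compactSpace_quotient {G : Type*} [Group G] [TopologicalSpace G]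
    (Γ : Subgroup G) [CompactSpace (G ⧸ Γ)] (p : ℕ → G → Prop)
    (hmono : ∀ m n g, m ≤ n → p m g → p n g) (hopen : ∀ n, IsOpen {g | p n g})
    (hinv : ∀ n g, ∀ γ ∈ Γ, p n g → p n (g * γ)) (hex : ∀ g, ∃ n, p n g) :
    ∃ n, ∀ g, p n g := by
  let U : ℕ → Set (G ⧸ Γ) := fun n => {q | ∃ g, p n g ∧ (QuotientGroup.mk g : G ⧸ Γ) = q}
  have hU : ∀ n, IsOpen (U n) := by
    intro n
    have h1 : (QuotientGroup.mk : G → G ⧸ Γ) ⁻¹' U n = {g | p n g} := by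
      ext g
      constructor
      · rintro ⟨g', hg', h⟩
        have := hinv n g' _ (QuotientGroup.eq.1 h) hg'
        rwa [mul_inv_cancel_left] at this
      · exact fun h => ⟨g, h, rfl⟩
    exact isOpen_coinduced.2 (h1 ▸ hopen n)
  have hdir : Directed (· ⊆ ·) U := by
    refine directed_of_isDirected_le fun m n hmn => ?_
    rintro _ ⟨g, hg, rfl⟩
    exact ⟨g, hmono _ _ _ hmn hg, rfl⟩
  obtain ⟨n, hn⟩ := isCompact_univ.elim_directed_cover U hU (by
    intro q _
    induction q using QuotientGroup.induction_on with
    | H g =>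
      obtain ⟨n, hn⟩ := hex g
      exact Set.mem_iUnion.2 ⟨n, g, hn, rfl⟩) hdir
  refine ⟨n, fun g => ?_⟩
  obtain ⟨g', hg', h⟩ := hn (Set.mem_univ (QuotientGroup.mk g : G ⧸ Γ))
  have := hinv n g' _ (QuotientGroup.eq.1 h) hg'
  rwa [mul_inv_cancel_left] at this

theorem inv_apply_eq_of_agree {g h : T ≃g T} {a : V} (hh : h (g⁻¹ a) = g (g⁻¹ a)) :
    h⁻¹ a = g⁻¹ a := by
  rw [RelIso.apply_inv_self] at hh
  conv_lhs => rw [← hh]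
  exact RelIso.inv_apply_self h _

theorem boundedOnOrbits {Γ : Subgroup (G₁ × G₂)} (hΓ : CompactSpace ((G₁ × G₂) ⧸ Γ)) :
    BoundedOnOrbits G₁ G₂ (fstAction Γ) (sndAction Γ) := by
  intro a₁ a₂ p hp₁ hp₂ hp₃
  -- The quotient is by right translations of `Γ`, so pairs of vertices are pulled back along the
  -- inverses.
  let q : ℕ → G₁ × G₂ → Prop := fun n g => p n (g.1.1⁻¹ a₁) (g.2.1⁻¹ a₂)
  have hopen : ∀ n, IsOpen {g | q n g} := by
    intro n
    refine isOpen_iff_mem_nhds.2 fun g hg => mem_nhds_prod_subgroup_iff.2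
      ⟨{g.1.1⁻¹ a₁}, {g.2.1⁻¹ a₂}, Set.finite_singleton _, Set.finite_singleton _,
        fun h hh₁ hh₂ => ?_⟩
    change p n (h.1.1⁻¹ a₁) (h.2.1⁻¹ a₂)
    rw [inv_apply_eq_of_agree (hh₁ _ rfl), inv_apply_eq_of_agree (hh₂ _ rfl)]
    exact hg
  have hright : ∀ n g, ∀ γ ∈ Γ, q n g → q n (g * γ) := by
    intro n g γ hγ hg
    have := hp₂ n ⟨γ, hγ⟩⁻¹ _ _ hg
    simpa [q, fstAction, sndAction, mul_inv_rev, RelIso.mul_apply] using this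
  obtain ⟨n, hn⟩ := exists_forall_of_compactSpace_quotient Γ q (fun m n g => hp₁ m n _ _) hopen
    hright fun g => hp₃ _ _
  refine ⟨n, fun g₁ h₁ g₂ h₂ => ?_⟩
  have := hn (⟨g₁, h₁⟩⁻¹, ⟨g₂, h₂⟩⁻¹)
  simpa [q] using this

end Topology

/-! ### The neighbourhood of the identity -/

theorem theorem2p3 {V₁ V₂ : Type*} (T₁ : SimpleGraph V₁) (T₂ : SimpleGraph V₂)
    (hT₁ : T₁.IsTree) (hT₂ : T₂.IsTree)
    (hfin₁ : ∀ x, (T₁.neighborSet x).Finite) (hfin₂ : ∀ x, (T₂.neighborSet x).Finite)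
    (G₁ : Subgroup (T₁ ≃g T₁)) (G₂ : Subgroup (T₂ ≃g T₂))
    (hclosed₁ : IsClosed (G₁ : Set (T₁ ≃g T₁))) (hclosed₂ : IsClosed (G₂ : Set (T₂ ≃g T₂)))
    (hnd₁ : ¬ DiscreteTopology G₁) (hnd₂ : ¬ DiscreteTopology G₂)
    (hct₁ : IsConstantType G₁) (hct₂ : IsConstantType G₂)
    (hqp₁ : IsLocallyQuasiPrimitive G₁) (hqp₂ : IsLocallyQuasiPrimitive G₂)
    (Γ : Subgroup (G₁ × G₂)) (hΓ : IsCocompactLattice Γ)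
    (hdense₁ : Dense (Γ.map (MonoidHom.fst G₁ G₂) : Set G₁))
    (hdense₂ : Dense (Γ.map (MonoidHom.snd G₁ G₂) : Set G₂)) :
    ∃ W ∈ 𝓝 (1 : G₁ × G₂), ∀ Λ : Subgroup (G₁ × G₂), DiscreteTopology Λ → Γ ≤ Λ →
      (Λ : Set (G₁ × G₂)) ∩ W ≠ {1} →
        (∀ (x₁ : V₁) (N₁ M₁ : Subgroup (localGroup G₁ x₁)),
          IsMinimalNormalSubgroup N₁ → IsSimpleFactor M₁ N₁ →
          ∀ (x₂ : V₂) (e₂ : T₂.neighborSet x₂),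
            IsSection M₁ (MulAction.stabilizer (localGroup G₂ x₂) e₂)) ∧
        (∀ (x₂ : V₂) (N₂ M₂ : Subgroup (localGroup G₂ x₂)),
          IsMinimalNormalSubgroup N₂ → IsSimpleFactor M₂ N₂ →
          ∀ (x₁ : V₁) (e₁ : T₁.neighborSet x₁),
            IsSection M₂ (MulAction.stabilizer (localGroup G₁ x₁) e₁)) := by
  have hn₁ := hasNontrivialFixators_of_not_discreteTopology hnd₁
  have hn₂ := hasNontrivialFixators_of_not_discreteTopology hnd₂
  have hb := boundedOnOrbits hΓ.2
  obtain ⟨x₁⟩ := hT₁.connected.nonempty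
  obtain ⟨x₂⟩ := hT₂.connected.nonempty
  obtain ⟨R₂, hR₂⟩ := hb.exists_radius hT₁ hT₂ hfin₁ hfin₂ hn₁ hn₂ hct₁ hct₂ hqp₁ hqp₂
    (fun l => l.1.1.2) (fstAction_dense hdense₁) x₂
  obtain ⟨R₁, hR₁⟩ := hb.symm.exists_radius hT₂ hT₁ hfin₂ hfin₁ hn₂ hn₁ hct₂ hct₁ hqp₂ hqp₁
    (fun l => l.1.2.2) (sndAction_dense hdense₂) x₁
  -- `R₁` is used on `T₁` for the sections in local groups of `G₁`, and `R₂` on `T₂` for those of `G₂`.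
  refine ⟨{g | (∀ v, T₁.dist x₁ v ≤ R₁ → g.1.1 v = v) ∧ ∀ v, T₂.dist x₂ v ≤ R₂ → g.2.1 v = v},
    mem_nhds_prod_subgroup_iff.2 ⟨_, _, finite_setOf_dist_le hT₁.connected hfin₁ x₁ R₁,
      finite_setOf_dist_le hT₂.connected hfin₂ x₂ R₂, fun _ h₁ h₂ => ⟨h₁, h₂⟩⟩, ?_⟩
  intro Λ hΛ hle hne
  obtain ⟨l, hlΛ, hl, hl₁, hl₂⟩ : ∃ l ∈ Λ, l ≠ 1 ∧ (∀ v, T₁.dist x₁ v ≤ R₁ → l.1.1 v = v) ∧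
      ∀ v, T₂.dist x₂ v ≤ R₂ → l.2.1 v = v := by
    by_contra! h
    refine hne (Set.Subset.antisymm ?_ ?_)
    · rintro l ⟨hl, h₁, h₂⟩
      by_contra hl1
      obtain ⟨v, hv, hv'⟩ := h l hl hl1 h₁
      exact hv' (h₂ v hv)
    · rintro _ rfl
      exact ⟨one_mem Λ, fun _ _ => rfl, fun _ _ => rfl⟩
  have hpair := isDiscreteDensePair hΛ (hdense₁.mono (Subgroup.map_mono hle))
    (hdense₂.mono (Subgroup.map_mono hle))
  have hl' : (⟨l, hlΛ⟩ : Λ) ≠ 1 := fun h => hl (congrArg Subtype.val h)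
  exact ⟨hR₂ (Subgroup.inclusion hle) _ _ rfl rfl hpair x₁ ⟨l, hlΛ⟩ hl' (hl₁ x₁ (by simp)) hl₂,
    hR₁ (Subgroup.inclusion hle) _ _ rfl rfl hpair.symm x₂ ⟨l, hlΛ⟩ hl' (hl₂ x₂ (by simp)) hl₁⟩
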